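/- Let $d\ge 2$, and let $q:\mathbb{R}^d\to(0,\infty)$ be a radial probability density with exponential decay, that is, $q(x)=L(|x|)\,e^{-\psi(|x|)}$ for all $x\in\mathbb{R}^d$, where - $L$ is regularly varying at infinity with some exponent $\alpha\in\mathbb{R}$ (a function $f$, positive near infinity, is regularly varying with exponent $\alpha$, written $f\in RV_\alpha$, if $\lim_{R\to\infty} f(tR)/f(R)=t^\alpha$ for every $t>0$); - $\psi\in C^2([0,\infty);[0,\infty))$ is of von Mises type, that is, $\psi'(z)>0$ for all large $z$, and $\psi(z)\to\infty$ and $(1/\psi')'(z)\to 0$ as $z\to\infty$; moreover, $\psi'$ is monotone on some half-line $[z_0,\infty)$; - $\psi\in RV_1$. Let $\psi^{\leftarrow}$ be any function that is an inverse of $\psi$ near infinity, that is, $\psi^{\leftarrow}(\psi(z))=z$ and $\psi(\psi^{\leftarrow}(s))=s$ for all large $z$ and $s$. Let $(r_n)_n$ be a non-increasing sequence with $0<r_n\le 1$ and $$ r_n\,\psi'(\psi^{\leftarrow}(\log n))=O(1)\qquad (n\to\infty). $$ For each $n$, let $\mathcal P_n=\{x_1,\dots,x_N\}$ be a Poisson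 point process of intensity $n\,q(x)\,dx$, where $x_1,x_2,\dots$ are i.i.d. with density $q$ and $N$ is Poisson distributed with mean $n$ and independent of the $x_i$'s. Let $G(\mathcal P_n,r_n)$ be the graph with vertex set $\mathcal P_n$ in which two distinct points are joined by an edge if and only if their distance is less than $r_n$. Then $G(\mathcal P_n,r_n)$ is disconnected (that is, it has two vertices not joined by a path) with high probability: $$ \lim_{n\to\infty}\mathbb{P}\big(G(\mathcal P_n,r_n)\text{ is disconnected}\big)=1. $$ -/

import Mathlib

open MeasureTheory ProbabilityTheory Filter Set
open scoped Topology ENNReal NNReal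

/-- `f` is regularly varying at infinity with exponent `α`: it is positive near infinity and
`f (t R) / f R → t ^ α` as `R → ∞`, for every `t > 0`. -/
def IsRegularlyVarying (f : ℝ → ℝ) (α : ℝ) : Prop :=
  (∀ᶠ R in atTop, 0 < f R) ∧
    ∀ t : ℝ, 0 < t → Tendsto (fun R : ℝ => f (t * R) / f R) atTop (𝓝 (t ^ α))

/-- `ψ` is a nonnegative `C²` function on `[0, ∞)` of von Mises type: near infinity `ψ' > 0`,
`ψ → ∞`, and `(1 / ψ')' → 0`. The values of `ψ` on the negative reals play no role. -/
structure IsVonMises (ψ : ℝ → ℝ) : Prop where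
  contDiffOn : ContDiffOn ℝ 2 ψ (Ici 0)
  nonneg : ∀ z, 0 ≤ z → 0 ≤ ψ z
  deriv_pos : ∀ᶠ z in atTop, 0 < deriv ψ z
  tendsto_atTop : Tendsto ψ atTop atTop
  tendsto_deriv_inv : Tendsto (deriv fun z => 1 / deriv ψ z) atTop (𝓝 0)

/-- `f` is monotone (in either direction) on some half-line `[z₀, ∞)`. -/
def EventuallyMonotone (f : ℝ → ℝ) : Prop :=
  ∃ z₀ : ℝ, MonotoneOn f (Ici z₀) ∨ AntitoneOn f (Ici z₀)

/-- `φ` is an inverse of `ψ` near infinity. -/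
def IsAsymptoticInverse (ψ φ : ℝ → ℝ) : Prop :=
  (∀ᶠ z in atTop, φ (ψ z) = z) ∧ ∀ᶠ s in atTop, ψ (φ s) = s

/-- A positive radial probability density on `ℝ^d`. -/
structure IsRadialDensity {d : ℕ} (q : EuclideanSpace ℝ (Fin d) → ℝ) : Prop where
  measurable : Measurable q
  pos : ∀ x, 0 < q x
  radial : ∀ x y, ‖x‖ = ‖y‖ → q x = q y
  lintegral_eq_one : ∫⁻ x, ENNReal.ofReal (q x) = 1

/-- `q` has a light tail, written as `q x = L |x| * exp (- ψ |x|)` with `ψ` of von Mises type,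
`ψ'` eventually monotone and `L` regularly varying of some exponent. -/
structure IsLightTail {d : ℕ} (q : EuclideanSpace ℝ (Fin d) → ℝ) (ψ L : ℝ → ℝ) : Prop where
  density : IsRadialDensity q
  vonMises : IsVonMises ψ
  deriv_monotone : EventuallyMonotone (deriv ψ)
  regularlyVarying : ∃ α : ℝ, IsRegularlyVarying L α
  eq : ∀ x, q x = L ‖x‖ * Real.exp (-ψ ‖x‖)

/-- `q` has exponential decay, with `ψ` and `L` the functions in its light-tail form. -/
structure HasExponentialDecay {d : ℕ} (q : EuclideanSpace ℝ (Fin d) → ℝ) (ψ L : ℝ → ℝ) :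
    Prop where
  lightTail : IsLightTail q ψ L
  regularlyVarying_one : IsRegularlyVarying ψ 1

/-- The probability measure on `ℝ^d` with density `q`. -/
noncomputable def densityMeasure {d : ℕ} (q : EuclideanSpace ℝ (Fin d) → ℝ) :
    Measure (EuclideanSpace ℝ (Fin d)) :=
  volume.withDensity fun x => ENNReal.ofReal (q x)

/-- The data of a Poisson point process of intensity `lam • ν`: a Poisson variable `N` of mean
`lam`, independent of an i.i.d. sequence `X 0, X 1, …` of law `ν`. -/
structure IsPoissonSample {Ω E : Type*} [MeasurableSpace Ω] [MeasurableSpace E]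
    (P : Measure Ω) (lam : ℝ≥0) (ν : Measure E) (N : Ω → ℕ) (X : ℕ → Ω → E) : Prop where
  law_count : HasLaw N (poissonMeasure lam) P
  law_point : ∀ i, HasLaw (X i) ν P
  indep_points : iIndepFun X P
  indep_count : IndepFun N (fun ω i => X i ω) P

/-- The random point set consisting of the first `N` points of the sequence `X`. -/
def pointCloud {Ω E : Type*} (N : Ω → ℕ) (X : ℕ → Ω → E) (ω : Ω) : Set E :=
  {x | ∃ i < N ω, x = X i ω}

/-- The geometric graph on a point set: distinct points at distance less than `r` are joined. -/
def geometricGraph {E : Type*} [PseudoMetricSpace E] (S : Set E) (r : ℝ) : SimpleGraph S where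
  Adj x y := x ≠ y ∧ dist (x : E) (y : E) < r
  symm := ⟨fun _ _ h => ⟨h.1.symm, by rw [dist_comm]; exact h.2⟩⟩
  loopless := ⟨fun _ h => h.1 rfl⟩

/-- A graph is disconnected if two of its vertices are not joined by a path (so graphs with at
most one vertex are not disconnected). -/
def IsDisconnected {V : Type*} (G : SimpleGraph V) : Prop :=
  ∃ u v : V, ¬ G.Reachable u v

/-!
The graph is disconnected because, at a suitable distance from the origin, small groups of points
are isolated with probability bounded away from `0`, and there is room for arbitrarily many
independent such groups.

Put `R = ψinv (log n)`, so that `n = exp (ψ R)`, and `s = min 1 (C / ψ' R)`, where `C` comes from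
the hypothesis on `r`; then `r n ≤ s` for large `n`. Since `ψ` is regularly varying of exponent `1`
and `ψ'` is monotone, `ψ' z` is comparable to `ψ z / z` (`exists_exponentBounds`), so that `ψ`
varies by a bounded amount over distances `s` at heights between `R / 2` and `2 R`. The same holds
for `log L` by a local boundedness form of the uniform convergence theorem for measurable
regularly varying functions (`exists_abs_increment_le`). Moreover `log L`, `log R` and `log s` are
of smaller order than `ψ R`, so `n q s ^ d` is large at height `R / 2` and small at height `2 R`.
In between there is a height `ρ` at which it is bounded above and below
(`exists_critical_radius`).

For each fixed `m` and large `n`, the sphere of radius `ρ` carries `m` points with disjoint balls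
of radius `2 s` around them. The expected number of sample points in each of these balls, and in
the concentric balls of radius `s`, lies between two positive constants. By the void probabilities
of a Poisson process (`IsPoissonSample.measureReal_voidEvent`), the events that the inner ball is
occupied while the surrounding shell is empty are pairwise independent and have probability at
least some `p > 0` which does not depend on `m`. Chebyshev's inequality shows that two of them
occur together with probability at least `1 - m / (m p - 1) ^ 2`
(`measureReal_setOf_two_events_ge`), and then the points in one of the inner balls cannot be joined
to those in the other. It remains to let `m → ∞`.
-/

/-! ### Void probabilities of a Poisson sample -/

/-- The event that none of the first `N` points of the sequence `X` falls into `S`. -/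
def voidEvent {Ω E : Type*} (N : Ω → ℕ) (X : ℕ → Ω → E) (S : Set E) : Set Ω :=
  {ω | ∀ i < N ω, X i ω ∉ S}

section Void

variable {Ω E : Type*} {N : Ω → ℕ} {X : ℕ → Ω → E}

lemma voidEvent_antitone {S T : Set E} (h : S ⊆ T) : voidEvent N X T ⊆ voidEvent N X S :=
  fun _ hω i hi hS => hω i hi (h hS)

lemma voidEvent_inter (S T : Set E) :
    voidEvent N X S ∩ voidEvent N X T = voidEvent N X (S ∪ T) := by
  ext ω
  simp only [voidEvent, mem_inter_iff, mem_ofPred_eq, mem_union, not_or]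
  exact ⟨fun h i hi => ⟨h.1 i hi, h.2 i hi⟩, fun h => ⟨fun i hi => (h i hi).1,
    fun i hi => (h i hi).2⟩⟩

lemma voidEvent_eq_iUnion (S : Set E) :
    voidEvent N X S =
      ⋃ j : ℕ, N ⁻¹' {j} ∩ (fun ω i => X i ω) ⁻¹' {x : ℕ → E | ∀ i < j, x i ∉ S} := by
  ext ω
  simp [voidEvent]

variable [MeasurableSpace Ω] [MeasurableSpace E] {P : Measure Ω} {lam : ℝ≥0} {ν : Measure E}

lemma measurableSet_forall_lt_notMem {S : Set E} (hS : MeasurableSet S) (j : ℕ) :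
    MeasurableSet {x : ℕ → E | ∀ i < j, x i ∉ S} := by
  have : {x : ℕ → E | ∀ i < j, x i ∉ S} = ⋂ i ∈ Finset.range j, (fun x => x i) ⁻¹' Sᶜ := by
    ext x; simp
  rw [this]
  exact Finset.measurableSet_biInter _ fun i _ => measurable_pi_apply i hS.compl

namespace IsPoissonSample

lemma nullMeasurableSet_piece (h : IsPoissonSample P lam ν N X) {S : Set E}
    (hS : MeasurableSet S) (j : ℕ) :
    NullMeasurableSet
      (N ⁻¹' {j} ∩ (fun ω i => X i ω) ⁻¹' {x : ℕ → E | ∀ i < j, x i ∉ S}) P := by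
  have hX : AEMeasurable (fun ω i => X i ω) P :=
    aemeasurable_pi_lambda _ fun i => (h.law_point i).aemeasurable
  exact (h.law_count.aemeasurable.nullMeasurableSet_preimage (measurableSet_singleton j)).inter
    (hX.nullMeasurableSet_preimage (measurableSet_forall_lt_notMem hS j))

lemma nullMeasurableSet_voidEvent (h : IsPoissonSample P lam ν N X) {S : Set E}
    (hS : MeasurableSet S) : NullMeasurableSet (voidEvent N X S) P := by
  rw [voidEvent_eq_iUnion]
  exact NullMeasurableSet.iUnion fun j => h.nullMeasurableSet_piece hS j

lemma measure_piece (h : IsPoissonSample P lam ν N X) {S : Set E}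
    (hS : MeasurableSet S) (j : ℕ) :
    P (N ⁻¹' {j} ∩ (fun ω i => X i ω) ⁻¹' {x : ℕ → E | ∀ i < j, x i ∉ S}) =
      poissonMeasure lam {j} * ν Sᶜ ^ j := by
  rw [h.indep_count.measure_inter_preimage_eq_mul _ _ (measurableSet_singleton j)
    (measurableSet_forall_lt_notMem hS j)]
  congr 1
  · rw [← h.law_count.map_eq,
      Measure.map_apply_of_aemeasurable h.law_count.aemeasurable (measurableSet_singleton j)]
  · have : (fun ω i => X i ω) ⁻¹' {x : ℕ → E | ∀ i < j, x i ∉ S} =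
        ⋂ i ∈ Finset.range j, X i ⁻¹' Sᶜ := by
      ext x; simp
    rw [this, h.indep_points.measure_inter_preimage_eq_mul _ fun _ _ => hS.compl]
    have hi : ∀ i ∈ Finset.range j, P (X i ⁻¹' Sᶜ) = ν Sᶜ := fun i _ => by
      rw [← (h.law_point i).map_eq,
        Measure.map_apply_of_aemeasurable (h.law_point i).aemeasurable hS.compl]
    rw [Finset.prod_congr rfl hi, Finset.prod_const, Finset.card_range]

/-- The void probabilities of a Poisson process: the points all avoid `S` with probability
`exp (-lam * ν S)`. This is the only consequence of the Poisson hypothesis that is needed. -/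
lemma measureReal_voidEvent [IsProbabilityMeasure ν] (h : IsPoissonSample P lam ν N X)
    {S : Set E} (hS : MeasurableSet S) :
    P.real (voidEvent N X S) = Real.exp (-(lam * ν.real S)) := by
  have hsum : HasSum (fun j : ℕ => Real.exp (-lam) * (lam * ν.real Sᶜ) ^ j / j.factorial)
      (Real.exp (-(lam * ν.real S))) := by
    have := (NormedSpace.expSeries_div_hasSum_exp ((lam : ℝ) * ν.real Sᶜ)).mul_left
      (Real.exp (-lam))
    rw [← Real.exp_eq_exp_ℝ, ← Real.exp_add, probReal_compl_eq_one_sub hS] at this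
    rw [probReal_compl_eq_one_sub hS]
    convert! this using 1
    · ext j; ring
    · congr 1; ring
  have hP : P (voidEvent N X S) = ENNReal.ofReal (Real.exp (-(lam * ν.real S))) := by
    rw [voidEvent_eq_iUnion, measure_iUnion₀ _ fun j => h.nullMeasurableSet_piece hS j,
      ← hsum.tsum_eq, ENNReal.ofReal_tsum_of_nonneg (fun j => by positivity) hsum.summable]
    · refine tsum_congr fun j => ?_
      rw [h.measure_piece hS, poissonMeasure_singleton,
        ← ENNReal.ofReal_toReal (measure_ne_top ν Sᶜ), ← measureReal_def,
        ← ENNReal.ofReal_pow measureReal_nonneg, ← ENNReal.ofReal_mul (by positivity)]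
      congr 1
      ring
    · intro i j hij
      refine Disjoint.aedisjoint ?_
      rw [Set.disjoint_left]
      rintro ω ⟨hi, _⟩ ⟨hj, _⟩
      exact hij (hi.symm.trans hj)
  rw [measureReal_def, hP, ENNReal.toReal_ofReal (Real.exp_pos _).le]

lemma measureReal_voidEvent_inter [IsProbabilityMeasure ν] (h : IsPoissonSample P lam ν N X)
    {S T : Set E} (hS : MeasurableSet S) (hT : MeasurableSet T) (hST : Disjoint S T) :
    P.real (voidEvent N X S ∩ voidEvent N X T) =
      P.real (voidEvent N X S) * P.real (voidEvent N X T) := by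
  rw [voidEvent_inter, h.measureReal_voidEvent (hS.union hT), h.measureReal_voidEvent hS,
    h.measureReal_voidEvent hT, measureReal_union hST hT, ← Real.exp_add]
  congr 1; ring

end IsPoissonSample

end Void

/-! ### Isolated groups of points -/

/-- The event that the sample has points in `A`, but none in `B \ A`. -/
def isolationEvent {Ω E : Type*} (N : Ω → ℕ) (X : ℕ → Ω → E) (A B : Set E) : Set Ω :=
  voidEvent N X (B \ A) \ voidEvent N X B

section Isolation

variable {Ω E : Type*} {N : Ω → ℕ} {X : ℕ → Ω → E}

lemma measureReal_diff_inter [MeasurableSpace Ω] {P : Measure Ω} [IsFiniteMeasure P]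
    {U V W : Set Ω} (hVU : V ⊆ U) (hV : NullMeasurableSet V P) (hW : NullMeasurableSet W P) :
    P.real ((U \ V) ∩ W) = P.real (U ∩ W) - P.real (V ∩ W) := by
  have : (U \ V) ∩ W = (U ∩ W) \ (V ∩ W) := by
    ext ω; simp only [mem_inter_iff, Set.mem_sdiff]; tauto
  rw [this, measureReal_def, measure_sdiff (inter_subset_inter_left W hVU) (hV.inter hW)
    (measure_ne_top _ _), ENNReal.toReal_sub_of_le (measure_mono (inter_subset_inter_left W hVU))
    (measure_ne_top _ _)]
  rfl

/-- If the part of a point set in `A` is isolated from the rest of the set, and so is its part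
in a remote set `A'`, then the geometric graph is disconnected. -/
lemma isDisconnected_of_mem_isolationEvent [PseudoMetricSpace E] {A B A' B' : Set E} {r : ℝ}
    (hAB : ∀ u ∈ A, ∀ v, dist u v < r → v ∈ B) (hdisj : Disjoint B B') {ω : Ω}
    (h : ω ∈ isolationEvent N X A B) (h' : ω ∈ isolationEvent N X A' B') :
    IsDisconnected (geometricGraph (pointCloud N X ω) r) := by
  have key : ∀ {A B : Set E}, ω ∈ isolationEvent N X A B →
      (∃ i < N ω, X i ω ∈ A ∧ X i ω ∈ B) ∧ ∀ i < N ω, X i ω ∈ B → X i ω ∈ A := by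
    intro A B h
    have h1 : ∀ i < N ω, X i ω ∈ B → X i ω ∈ A := fun i hi hB => by
      by_contra hA
      exact h.1 i hi ⟨hB, hA⟩
    have h2 := h.2
    simp only [voidEvent, mem_ofPred_eq, not_forall, not_not] at h2
    obtain ⟨i, hi, hB⟩ := h2
    exact ⟨⟨i, hi, h1 i hi hB, hB⟩, h1⟩
  obtain ⟨⟨i, hi, hiA, hiB⟩, hclosed⟩ := key h
  obtain ⟨⟨j, hj, -, hjB'⟩, -⟩ := key h'
  refine ⟨⟨X i ω, i, hi, rfl⟩, ⟨X j ω, j, hj, rfl⟩, ?_⟩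
  rintro ⟨w⟩
  -- a path that starts in `A` never leaves `A`
  have hwalk : ∀ {u v : pointCloud N X ω}, (geometricGraph (pointCloud N X ω) r).Walk u v →
      (u : E) ∈ B → (u : E) ∈ A → (v : E) ∈ B := by
    intro u v w
    induction w with
    | nil => exact fun hB _ => hB
    | @cons u v _ hadj _ ih =>
      intro _ hA
      have hvB : (v : E) ∈ B := hAB _ hA _ hadj.2
      obtain ⟨k, hk, hvk⟩ := v.2
      exact ih hvB (by rw [hvk] at hvB ⊢; exact hclosed k hk hvB)
  exact Set.disjoint_left.1 hdisj (hwalk w hiB hiA) hjB'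

section Poisson

variable [MeasurableSpace Ω] [MeasurableSpace E] {P : Measure Ω}
  {lam : ℝ≥0} {ν : Measure E}

lemma IsPoissonSample.nullMeasurableSet_isolationEvent (h : IsPoissonSample P lam ν N X)
    {A B : Set E} (hA : MeasurableSet A) (hB : MeasurableSet B) :
    NullMeasurableSet (isolationEvent N X A B) P :=
  (h.nullMeasurableSet_voidEvent (hB.diff hA)).diff (h.nullMeasurableSet_voidEvent hB)

variable [IsFiniteMeasure P] [IsProbabilityMeasure ν]

/-- Isolation events of disjoint sets are independent. -/
lemma IsPoissonSample.measureReal_isolationEvent_inter (h : IsPoissonSample P lam ν N X)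
    {A B A' B' : Set E} (hA : MeasurableSet A) (hB : MeasurableSet B)
    (hA' : MeasurableSet A') (hB' : MeasurableSet B') (hdisj : Disjoint B B') :
    P.real (isolationEvent N X A B ∩ isolationEvent N X A' B') =
      P.real (isolationEvent N X A B) * P.real (isolationEvent N X A' B') := by
  have key : ∀ {A B : Set E}, MeasurableSet A → MeasurableSet B →
      ∀ {W : Set Ω}, NullMeasurableSet W P → P.real (isolationEvent N X A B ∩ W) =
        P.real (voidEvent N X (B \ A) ∩ W) - P.real (voidEvent N X B ∩ W) :=
    fun _ hB _ hW => measureReal_diff_inter (voidEvent_antitone sdiff_subset)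
      (h.nullMeasurableSet_voidEvent hB) hW
  have key1 : ∀ {A B : Set E}, MeasurableSet A → MeasurableSet B →
      P.real (isolationEvent N X A B) =
        P.real (voidEvent N X (B \ A)) - P.real (voidEvent N X B) := fun hA hB => by
    simpa using key hA hB (W := univ) MeasurableSet.univ.nullMeasurableSet
  have hBA := hB.diff hA
  have hBA' := hB'.diff hA'
  rw [key hA hB (h.nullMeasurableSet_isolationEvent hA' hB'),
    inter_comm (voidEvent N X (B \ A)), inter_comm (voidEvent N X B),
    key hA' hB' (h.nullMeasurableSet_voidEvent hBA),
    key hA' hB' (h.nullMeasurableSet_voidEvent hB),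
    h.measureReal_voidEvent_inter hBA' hBA (hdisj.symm.mono sdiff_subset sdiff_subset),
    h.measureReal_voidEvent_inter hB' hBA (hdisj.symm.mono le_rfl sdiff_subset),
    h.measureReal_voidEvent_inter hBA' hB (hdisj.symm.mono sdiff_subset le_rfl),
    h.measureReal_voidEvent_inter hB' hB hdisj.symm, key1 hA hB, key1 hA' hB']
  ring

lemma IsPoissonSample.le_measureReal_isolationEvent (h : IsPoissonSample P lam ν N X)
    {A B : Set E} (hA : MeasurableSet A) (hB : MeasurableSet B) (hAB : A ⊆ B) {a b : ℝ}
    (ha : a ≤ lam * ν.real A) (hb : lam * ν.real B ≤ b) (ha0 : 0 ≤ a) :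
    Real.exp (-b) * (1 - Real.exp (-a)) ≤ P.real (isolationEvent N X A B) := by
  have h1 : P.real (isolationEvent N X A B) =
      P.real (voidEvent N X (B \ A)) - P.real (voidEvent N X B) := by
    simpa [isolationEvent] using measureReal_diff_inter (W := univ) (P := P)
      (voidEvent_antitone (N := N) (X := X) (sdiff_subset (s := B) (t := A)))
      (h.nullMeasurableSet_voidEvent hB) MeasurableSet.univ.nullMeasurableSet
  have h2 : ν.real B = ν.real (B \ A) + ν.real A := by
    rw [← measureReal_union disjoint_sdiff_left hA, sdiff_union_of_subset hAB]
  rw [h1, h.measureReal_voidEvent (hB.diff hA), h.measureReal_voidEvent hB, h2, mul_add, neg_add,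
    Real.exp_add]
  have h3 : (lam : ℝ) * ν.real (B \ A) ≤ b := by
    refine le_trans ?_ hb
    rw [h2]
    gcongr
    linarith [measureReal_nonneg (μ := ν) (s := A)]
  have h4 : Real.exp (-b) ≤ Real.exp (-(lam * ν.real (B \ A))) :=
    Real.exp_le_exp.2 (by linarith)
  have h5 : Real.exp (-(lam * ν.real A)) ≤ Real.exp (-a) := Real.exp_le_exp.2 (by linarith)
  have h6 : Real.exp (-a) ≤ 1 := Real.exp_le_one_iff.2 (by linarith)
  nlinarith [Real.exp_pos (-b)]

end Poisson

end Isolation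

/-- Second moment method: among `m` pairwise independent events of probability at least `p`, two
distinct ones occur simultaneously with probability at least `1 - m / (m p - 1) ^ 2`. -/
lemma measureReal_setOf_two_events_ge {Ω : Type*} [MeasurableSpace Ω] {P : Measure Ω}
    [IsProbabilityMeasure P] {m : ℕ} {p : ℝ} (F : Fin m → Set Ω)
    (hF : ∀ k, NullMeasurableSet (F k) P)
    (hind : ∀ k l, k ≠ l → P.real (F k ∩ F l) = P.real (F k) * P.real (F l))
    (hp : ∀ k, p ≤ P.real (F k)) (hmp : 1 < m * p) :
    1 - m / (m * p - 1) ^ 2 ≤ P.real {ω | ∃ k l, k ≠ l ∧ ω ∈ F k ∧ ω ∈ F l} := by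
  classical
  set f : Fin m → Ω → ℝ := fun k => (F k).indicator 1 with hf
  have hint : ∀ {S : Set Ω}, NullMeasurableSet S P →
      ∫ ω, S.indicator (1 : Ω → ℝ) ω ∂P = P.real S := fun hS => by
    rw [integral_indicator₀ hS]; simp
  have hL2 : ∀ {S : Set Ω}, NullMeasurableSet S P → MemLp (S.indicator (1 : Ω → ℝ)) 2 P :=
    fun {S} hS => by
      refine MemLp.of_bound (aestronglyMeasurable_const.indicator₀ hS) 1 (ae_of_all _ fun ω => ?_)
      by_cases h : ω ∈ S <;> simp [h]
  have hfL2 : ∀ k, MemLp (f k) 2 P := fun k => hL2 (hF k)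
  have hcov : ∀ k l, cov[f k, f l; P] = P.real (F k ∩ F l) - P.real (F k) * P.real (F l) := by
    intro k l
    rw [covariance_eq_sub (hfL2 k) (hfL2 l), hint (hF k), hint (hF l),
      ← hint ((hF k).inter (hF l))]
    congr 2
    ext ω
    simp [hf, Set.indicator_apply, ← ite_and, and_comm]
  have hvar : Var[∑ k, f k; P] ≤ m := by
    rw [variance_sum fun k => hfL2 k]
    calc ∑ k, ∑ l, cov[f k, f l; P] ≤ ∑ k : Fin m, (1 : ℝ) := by
          refine Finset.sum_le_sum fun k _ => ?_
          rw [Finset.sum_eq_single k]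
          · rw [hcov, inter_self]
            nlinarith [measureReal_le_one (μ := P) (s := F k),
              measureReal_nonneg (μ := P) (s := F k)]
          · intro l _ hl
            rw [hcov, hind k l hl.symm, sub_self]
          · simp
      _ = m := by simp
  set M : ℝ := ∫ ω, (∑ k, f k) ω ∂P with hM
  have hmean : m * p ≤ M := by
    have : M = ∑ k, P.real (F k) := by
      rw [hM]
      simp only [Finset.sum_apply]
      rw [integral_finsetSum _ fun k _ => (hfL2 k).integrable (by norm_num)]
      exact Finset.sum_congr rfl fun k _ => hint (hF k)
    rw [this]
    calc (m : ℝ) * p = ∑ _k : Fin m, p := by simp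
      _ ≤ _ := Finset.sum_le_sum fun k _ => hp k
  have hc : 0 < M - 1 := by linarith
  have hcheb := meas_ge_le_variance_div_sq (memLp_finsetSum' Finset.univ fun k _ => hfL2 k) hc
  set D : Set Ω := {ω | M - 1 ≤ |(∑ k, f k) ω - M|} with hD
  have hsub : Dᶜ ⊆ {ω | ∃ k l, k ≠ l ∧ ω ∈ F k ∧ ω ∈ F l} := by
    intro ω hω
    by_contra hcon
    refine hω ?_
    -- if at most one of the events occurs then `∑ f k ≤ 1`
    have hle : (∑ k, f k) ω ≤ 1 := by
      have h1 : (∑ k, f k) ω = ((Finset.univ.filter fun k => ω ∈ F k).card : ℝ) := by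
        simp [hf, Set.indicator_apply, Finset.sum_boole]
      rw [h1]
      have h2 : (Finset.univ.filter fun k => ω ∈ F k).card ≤ 1 := by
        refine Finset.card_le_one.2 fun k hk l hl => ?_
        by_contra hkl
        simp only [Finset.mem_filter, Finset.mem_univ, true_and] at hk hl
        exact hcon ⟨k, l, hkl, hk, hl⟩
      exact_mod_cast h2
    change M - 1 ≤ |(∑ k, f k) ω - M|
    rw [abs_sub_comm]
    exact le_trans (by linarith) (le_abs_self _)
  have hDm : NullMeasurableSet D P := by
    have := (memLp_finsetSum' Finset.univ fun k _ => hfL2 k).aestronglyMeasurable.aemeasurable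
    exact nullMeasurableSet_le aemeasurable_const (this.sub_const M).abs
  have hDle : P.real D ≤ m / (m * p - 1) ^ 2 := by
    have h1 : P.real D ≤ Var[∑ k, f k; P] / (M - 1) ^ 2 := by
      rw [measureReal_def]
      refine ENNReal.toReal_le_of_le_ofReal
        (div_nonneg (variance_nonneg _ _) (sq_nonneg _)) hcheb
    refine h1.trans ?_
    have h3 : 0 < m * p - 1 := by linarith
    gcongr
  calc 1 - m / (m * p - 1) ^ 2 ≤ 1 - P.real D := by linarith
    _ = P.real Dᶜ := by rw [measureReal_compl₀ hDm, probReal_univ]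
    _ ≤ _ := measureReal_mono hsub

/-- A Poisson sample that has, in expectation, a bounded but not too small number of points in
each of many disjoint sets `B k`, whose cores `A k` are at distance at least `r` from the
complement of `B k`, has a disconnected geometric graph with large probability. -/
lemma IsPoissonSample.le_measureReal_isDisconnected {Ω E : Type*} [MeasurableSpace Ω]
    [MeasurableSpace E] [PseudoMetricSpace E] {P : Measure Ω} [IsProbabilityMeasure P]
    {lam : ℝ≥0} {ν : Measure E} [IsProbabilityMeasure ν] {N : Ω → ℕ} {X : ℕ → Ω → E}
    (h : IsPoissonSample P lam ν N X) {m : ℕ} {a b r : ℝ} (A B : Fin m → Set E)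
    (hA : ∀ k, MeasurableSet (A k)) (hB : ∀ k, MeasurableSet (B k)) (hAB : ∀ k, A k ⊆ B k)
    (hr : ∀ k, ∀ u ∈ A k, ∀ v, dist u v < r → v ∈ B k)
    (hdisj : ∀ k l, k ≠ l → Disjoint (B k) (B l)) (ha0 : 0 ≤ a)
    (ha : ∀ k, a ≤ lam * ν.real (A k)) (hb : ∀ k, lam * ν.real (B k) ≤ b)
    (hmp : 1 < m * (Real.exp (-b) * (1 - Real.exp (-a)))) :
    1 - m / (m * (Real.exp (-b) * (1 - Real.exp (-a))) - 1) ^ 2 ≤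
      P.real {ω | IsDisconnected (geometricGraph (pointCloud N X ω) r)} := by
  refine (measureReal_setOf_two_events_ge (fun k => isolationEvent N X (A k) (B k))
    (fun k => h.nullMeasurableSet_isolationEvent (hA k) (hB k))
    (fun k l hkl => h.measureReal_isolationEvent_inter (hA k) (hB k) (hA l) (hB l)
      (hdisj k l hkl))
    (fun k => h.le_measureReal_isolationEvent (hA k) (hB k) (hAB k) (ha k) (hb k) ha0)
    hmp).trans (measureReal_mono ?_)
  rintro ω ⟨k, l, hkl, hk, hl⟩
  exact isDisconnected_of_mem_isolationEvent (hr k) (hdisj k l hkl) hk hl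

/-! ### Regularly varying functions -/

/-- Egorov-type step: if the increments `h (x + u) - h x` tend to `0` for each `u`, then along a
sequence `y n → ∞` they are eventually at most `1` for `u` in a large part of `[0, 2]`. -/
lemma eventually_volume_increment_le {h : ℝ → ℝ}
    (hlim : ∀ u, Tendsto (fun x => h (x + u) - h x) atTop (𝓝 0)) {y : ℕ → ℝ}
    (hy : Tendsto y atTop atTop) :
    ∀ᶠ n in atTop,
      ENNReal.ofReal (3 / 2) <
        volume {t ∈ Icc (0 : ℝ) 2 | ∀ j, n ≤ j → |h (y j + t) - h (y j)| ≤ 1} := by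
  set U : ℕ → Set ℝ := fun n => {t ∈ Icc (0 : ℝ) 2 | ∀ j, n ≤ j → |h (y j + t) - h (y j)| ≤ 1}
  have hmono : Monotone U := fun n n' hn t ht => ⟨ht.1, fun j hj => ht.2 j (hn.trans hj)⟩
  have hU : ⋃ n, U n = Icc (0 : ℝ) 2 := by
    ext t
    simp only [mem_iUnion]
    refine ⟨fun ⟨n, hn⟩ => hn.1, fun ht => ?_⟩
    have h1 := ((hlim t).comp hy).abs
    rw [abs_zero] at h1
    obtain ⟨n, hn⟩ := eventually_atTop.1 (h1.eventually (eventually_le_nhds one_pos))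
    exact ⟨n, ht, fun j hj => hn j hj⟩
  have hlimU := tendsto_measure_iUnion_atTop (μ := volume) hmono
  rw [hU, Real.volume_Icc, sub_zero] at hlimU
  exact hlimU.eventually (lt_mem_nhds ((ENNReal.ofReal_lt_ofReal_iff two_pos).2 (by norm_num)))

/-- Local boundedness of the increments of a measurable function `h` for which `h (x + u) - h x`
converges for each `u`: the additive form of the uniform convergence theorem for regularly varying
functions. If it failed along `x n` and `x n + u n`, two large subsets of `[0, 3]` would have to
be disjoint. -/
lemma exists_abs_increment_le {h : ℝ → ℝ} (hm : Measurable h) {α : ℝ}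
    (hlim : ∀ u, Tendsto (fun x => h (x + u) - h x) atTop (𝓝 (α * u))) :
    ∃ M X, ∀ x, X ≤ x → ∀ u ∈ Icc (0 : ℝ) 1, |h (x + u) - h x| ≤ M := by
  by_contra! hcon
  choose x hx u hu hxu using fun n : ℕ => hcon (|α| + 2) n
  set k : ℝ → ℝ := fun x => h x - α * x with hk
  have hkm : Measurable k := hm.sub (measurable_id.const_mul α)
  have hklim : ∀ u, Tendsto (fun x => k (x + u) - k x) atTop (𝓝 0) := fun u => by
    have := (hlim u).sub_const (α * u)
    rw [sub_self] at this
    refine this.congr fun x => ?_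
    simp only [hk]; ring
  have hbig : ∀ n, 2 < |k (x n + u n) - k (x n)| := fun n => by
    have h1 : h (x n + u n) - h (x n) = (k (x n + u n) - k (x n)) + α * u n := by
      simp only [hk]; ring
    have h2 : |α * u n| ≤ |α| := by
      rw [abs_mul, abs_of_nonneg (hu n).1]
      exact mul_le_of_le_one_right (abs_nonneg _) (hu n).2
    have h3 := hxu n
    rw [h1] at h3
    linarith [abs_add_le (k (x n + u n) - k (x n)) (α * u n)]
  have hxlim : Tendsto x atTop atTop :=
    tendsto_atTop_mono hx tendsto_natCast_atTop_atTop
  have hxulim : Tendsto (fun n => x n + u n) atTop atTop :=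
    tendsto_atTop_mono (fun n => by linarith [hx n, (hu n).1]) tendsto_natCast_atTop_atTop
  obtain ⟨n, hU, hV⟩ := ((eventually_volume_increment_le hklim hxlim).and
    (eventually_volume_increment_le hklim hxulim)).exists
  set U : Set ℝ := {t ∈ Icc (0 : ℝ) 2 | ∀ j, n ≤ j → |k (x j + t) - k (x j)| ≤ 1}
  set V : Set ℝ := {t ∈ Icc (0 : ℝ) 2 | ∀ j, n ≤ j → |k (x j + u j + t) - k (x j + u j)| ≤ 1}
    with hVdef
  have hVm : MeasurableSet V := by
    have : V = Icc (0 : ℝ) 2 ∩ ⋂ j, ⋂ (_ : n ≤ j),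
        {t | |k (x j + u j + t) - k (x j + u j)| ≤ 1} := by
      ext t; simp [hVdef]
    rw [this]
    refine measurableSet_Icc.inter (MeasurableSet.iInter fun j => MeasurableSet.iInter fun _ => ?_)
    exact measurableSet_le
      ((hkm.comp (measurable_const_add _)).sub_const _).abs measurable_const
  set W : Set ℝ := (fun t => t + (-u n)) ⁻¹' V with hW
  have hWm : MeasurableSet W := measurable_add_const _ hVm
  have hWvol : volume W = volume V := by rw [hW, measure_preimage_add_right]
  have hne : ¬ Disjoint U W := by
    intro hdisj
    have h1 : volume (U ∪ W) ≤ ENNReal.ofReal 3 := by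
      rw [show (3 : ℝ) = 3 - 0 by norm_num, ← Real.volume_Icc]
      refine measure_mono (union_subset (fun t ht => ?_) fun t ht => ?_)
      · exact ⟨ht.1.1, by linarith [ht.1.2]⟩
      · have := ht.1
        exact ⟨by linarith [this.1, (hu n).1], by linarith [this.2, (hu n).2]⟩
    rw [measure_union hdisj hWm, hWvol] at h1
    have h2 := ENNReal.add_lt_add hU hV
    rw [← ENNReal.ofReal_add (by norm_num) (by norm_num)] at h2
    norm_num at h2 h1
    exact absurd h1 (not_le.2 h2)
  obtain ⟨t, htU, htW⟩ := Set.not_disjoint_iff.1 hne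
  have h1 := htU.2 n le_rfl
  have h2 := htW.2 n le_rfl
  rw [show x n + u n + (t + -u n) = x n + t by ring] at h2
  have h3 := abs_sub_le (k (x n + u n)) (k (x n + t)) (k (x n))
  rw [abs_sub_comm (k (x n + u n)) (k (x n + t))] at h3
  linarith [hbig n]

/-- A function with bounded increments grows at most linearly. -/
lemma exists_abs_le_linear {h : ℝ → ℝ} {M X : ℝ}
    (hb : ∀ x, X ≤ x → ∀ u ∈ Icc (0 : ℝ) 1, |h (x + u) - h x| ≤ M) :
    ∃ K, 0 ≤ K ∧ ∀ᶠ x in atTop, |h x| ≤ K * (1 + x) := by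
  set Y := max X 0
  have hM : 0 ≤ M := (abs_nonneg _).trans (hb Y (le_max_left _ _) 0 ⟨le_rfl, zero_le_one⟩)
  have key : ∀ n : ℕ, ∀ x, Y ≤ x → x ≤ Y + (n + 1) → |h x - h Y| ≤ M * (n + 1) := by
    intro n
    induction n with
    | zero =>
      intro x hx hx'
      have := hb Y (le_max_left _ _) (x - Y) ⟨by linarith, by simp at hx'; linarith⟩
      simpa using this
    | succ n ih =>
      intro x hx hx'
      push_cast at hx' ⊢
      by_cases hxY : x ≤ Y + (n + 1)
      · exact (ih x hx hxY).trans (by nlinarith)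
      · have hx1 : Y ≤ x - 1 := by
          have : (0 : ℝ) ≤ n := Nat.cast_nonneg n
          linarith
        have h1 := ih (x - 1) hx1 (by linarith)
        have h2 := hb (x - 1) ((le_max_left _ _).trans hx1) 1 ⟨zero_le_one, le_rfl⟩
        rw [sub_add_cancel] at h2
        have h3 := abs_sub_le (h x) (h (x - 1)) (h Y)
        linarith
  refine ⟨|h Y| + M, by positivity, ?_⟩
  filter_upwards [eventually_ge_atTop Y] with x hx
  have hY : 0 ≤ Y := le_max_right _ _
  have h1 := key ⌊x - Y⌋₊ x hx (by linarith [Nat.lt_floor_add_one (x - Y)])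
  have h2 := Nat.floor_le (sub_nonneg.2 hx)
  have h3 : |h x| ≤ |h x - h Y| + |h Y| := by
    simpa using abs_add_le (h x - h Y) (h Y)
  have h4 : M * (⌊x - Y⌋₊ + 1) ≤ M * (1 + x) :=
    mul_le_mul_of_nonneg_left (by linarith) hM
  nlinarith [abs_nonneg (h Y)]

/-- The logarithm of a regularly varying function, in logarithmic scale, has convergent
increments. -/
lemma IsRegularlyVarying.tendsto_log_exp {L : ℝ → ℝ} {α : ℝ} (hL : IsRegularlyVarying L α)
    (u : ℝ) :
    Tendsto (fun x => Real.log (L (Real.exp (x + u))) - Real.log (L (Real.exp x))) atTop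
      (𝓝 (α * u)) := by
  have h1 := ((hL.2 (Real.exp u) (Real.exp_pos u)).comp Real.tendsto_exp_atTop).log
    (Real.rpow_pos_of_pos (Real.exp_pos u) α).ne'
  rw [Real.log_rpow (Real.exp_pos u), Real.log_exp] at h1
  refine h1.congr' ?_
  have hp := Real.tendsto_exp_atTop.eventually hL.1
  have hp' := (Real.tendsto_exp_atTop.comp (tendsto_atTop_add_const_right atTop u
    tendsto_id)).eventually hL.1
  filter_upwards [hp, hp'] with x hx hx'
  simp only [Function.comp_apply, id] at hx' ⊢
  rw [← Real.exp_add, add_comm u x, Real.log_div hx'.ne' hx.ne']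

/-- A measurable regularly varying function is comparable to itself on `[ρ, 2 ρ]`. -/
lemma IsRegularlyVarying.exists_abs_log_sub_le {L : ℝ → ℝ} {α : ℝ} (hL : IsRegularlyVarying L α)
    (hm : Measurable fun x => Real.log (L (Real.exp x))) :
    ∃ M, ∀ᶠ ρ in atTop, ∀ y ∈ Icc ρ (2 * ρ), |Real.log (L y) - Real.log (L ρ)| ≤ M := by
  obtain ⟨M, X, hMX⟩ := exists_abs_increment_le hm hL.tendsto_log_exp
  refine ⟨M, ?_⟩
  filter_upwards [eventually_ge_atTop (Real.exp X)] with ρ hρ y hy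
  have hρ0 : 0 < ρ := (Real.exp_pos X).trans_le hρ
  have hy0 : 0 < y := hρ0.trans_le hy.1
  have h1 := hMX (Real.log ρ) ((Real.le_log_iff_exp_le hρ0).2 hρ) (Real.log y - Real.log ρ)
    ⟨sub_nonneg.2 (Real.log_le_log hρ0 hy.1), ?_⟩
  · simpa [Real.exp_log hy0, Real.exp_log hρ0] using h1
  · have := Real.log_le_log hy0 hy.2
    rw [Real.log_mul two_ne_zero hρ0.ne'] at this
    linarith [Real.log_two_lt_d9]

/-- A measurable regularly varying function grows and decays at most polynomially. -/
lemma IsRegularlyVarying.exists_abs_log_le {L : ℝ → ℝ} {α : ℝ} (hL : IsRegularlyVarying L α)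
    (hm : Measurable fun x => Real.log (L (Real.exp x))) :
    ∃ K, 0 ≤ K ∧ ∀ᶠ ρ in atTop, |Real.log (L ρ)| ≤ K * (1 + Real.log ρ) := by
  obtain ⟨M, X, hMX⟩ := exists_abs_increment_le hm hL.tendsto_log_exp
  obtain ⟨K, hK, h⟩ := exists_abs_le_linear (h := fun x => Real.log (L (Real.exp x))) hMX
  refine ⟨K, hK, ?_⟩
  filter_upwards [Real.tendsto_log_atTop.eventually h, eventually_gt_atTop 0] with ρ h1 hρ
  rwa [Real.exp_log hρ] at h1

/-! ### The exponent -/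

/-- The quantitative properties of `ψ` beyond `Z` on which the choice of the radius rests. -/
structure ExponentBounds (ψ : ℝ → ℝ) (Z : ℝ) : Prop where
  one_le : 1 ≤ Z
  differentiableAt : ∀ z, Z ≤ z → DifferentiableAt ℝ ψ z
  deriv_pos : ∀ z, Z ≤ z → 0 < deriv ψ z
  one_le_apply : ∀ z, Z ≤ z → 1 ≤ ψ z
  le_double : ∀ z, Z ≤ z → 3 / 2 * ψ z ≤ ψ (2 * z)
  double_le : ∀ z, Z ≤ z → ψ (2 * z) ≤ 5 / 2 * ψ z
  le_deriv : ∀ z, Z ≤ z → ψ z / (2 * z) ≤ deriv ψ z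
  deriv_le : ∀ z, Z ≤ z → deriv ψ z ≤ 2 * ψ z / z

/-- A regularly varying `ψ` of exponent `1` with monotone derivative satisfies `ψ' z ≍ ψ z / z`,
by comparing `ψ' z` with the slopes of `ψ` on `[z / 2, z]` and `[z, 2 z]`. -/
lemma exists_exponentBounds {ψ : ℝ → ℝ} (hψ : IsVonMises ψ) (hmono : EventuallyMonotone (deriv ψ))
    (hrv : IsRegularlyVarying ψ 1) : ∃ Z, ExponentBounds ψ Z := by
  have hdiff : ∀ z, 0 < z → DifferentiableAt ℝ ψ z := fun z hz =>
    (hψ.contDiffOn.contDiffAt (Ici_mem_nhds hz)).differentiableAt (by norm_num)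
  have h2 := hrv.2 2 two_pos
  rw [Real.rpow_one] at h2
  have hev := (h2.eventually (Icc_mem_nhds (show (3 / 2 : ℝ) < 2 by norm_num)
    (show (2 : ℝ) < 5 / 2 by norm_num))).and
      (hψ.deriv_pos.and (hψ.tendsto_atTop.eventually_ge_atTop 1))
  obtain ⟨z₁, hz₁⟩ := eventually_atTop.1 hev
  obtain ⟨z₀, hz₀⟩ := hmono
  set Y := max 1 (max z₁ z₀)
  have hY1 : 1 ≤ Y := le_max_left _ _
  have hYz₁ : z₁ ≤ Y := (le_max_left _ _).trans (le_max_right _ _)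
  have hYz₀ : z₀ ≤ Y := (le_max_right _ _).trans (le_max_right _ _)
  have hpos : ∀ z, Y ≤ z → 1 ≤ ψ z := fun z hz => (hz₁ z (hYz₁.trans hz)).2.2
  have hle : ∀ z, Y ≤ z → 3 / 2 * ψ z ≤ ψ (2 * z) := fun z hz =>
    (le_div_iff₀ (by linarith [hpos z hz])).1 (hz₁ z (hYz₁.trans hz)).1.1
  have hge : ∀ z, Y ≤ z → ψ (2 * z) ≤ 5 / 2 * ψ z := fun z hz =>
    (div_le_iff₀ (by linarith [hpos z hz])).1 (hz₁ z (hYz₁.trans hz)).1.2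
  have hslope : ∀ a b, Y ≤ a → a < b → ∃ c ∈ Ioo a b, deriv ψ c * (b - a) = ψ b - ψ a := by
    intro a b ha hab
    have hd : ∀ z, a ≤ z → DifferentiableAt ℝ ψ z := fun z hz => hdiff z (by linarith)
    obtain ⟨c, hc, hc'⟩ := exists_deriv_eq_slope ψ hab
      (fun z hz => (hd z hz.1).continuousAt.continuousWithinAt)
      (fun z hz => (hd z hz.1.le).differentiableWithinAt)
    exact ⟨c, hc, by rw [hc', div_mul_cancel₀ _ (by linarith)]⟩
  have hder : ∀ z, 2 * Y ≤ z → ψ z / (2 * z) ≤ deriv ψ z ∧ deriv ψ z ≤ 2 * ψ z / z := by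
    intro z hz
    have hz0 : 0 < z := by linarith
    obtain ⟨c, hc, hcs⟩ := hslope z (2 * z) (by linarith) (by linarith)
    obtain ⟨e, he, hes⟩ := hslope (z / 2) z (by linarith) (by linarith)
    have p1 := hpos z (by linarith)
    have p2 := hpos (z / 2) (by linarith)
    have q1 := hle z (by linarith)
    have q2 := hge z (by linarith)
    have q3 := hle (z / 2) (by linarith)
    rw [mul_div_cancel₀ z two_ne_zero] at q3
    rw [div_le_iff₀ (by linarith), le_div_iff₀ hz0]
    have m0 : z ∈ Ici z₀ := by simp only [mem_Ici]; linarith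
    have m1 : c ∈ Ici z₀ := by simp only [mem_Ici]; linarith [hc.1]
    have m2 : e ∈ Ici z₀ := by simp only [mem_Ici]; linarith [he.1]
    rcases hz₀ with hm | hm
    · have r1 := hm m0 m1 hc.1.le
      have r2 := hm m2 m0 he.2.le
      constructor <;> nlinarith
    · have r1 := hm m0 m1 hc.1.le
      have r2 := hm m2 m0 he.2.le
      constructor <;> nlinarith
  refine ⟨2 * Y, by linarith, fun z hz => hdiff z (by linarith),
    fun z hz => (hz₁ z (by linarith)).2.1, fun z hz => hpos z (by linarith),
    fun z hz => hle z (by linarith), fun z hz => hge z (by linarith),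
    fun z hz => (hder z hz).1, fun z hz => (hder z hz).2⟩

namespace ExponentBounds

variable {ψ : ℝ → ℝ} {Z : ℝ}

lemma continuousOn (h : ExponentBounds ψ Z) : ContinuousOn ψ (Ici Z) := fun z hz =>
  (h.differentiableAt z hz).continuousAt.continuousWithinAt

lemma monotoneOn (h : ExponentBounds ψ Z) : MonotoneOn ψ (Ici Z) := by
  refine monotoneOn_of_deriv_nonneg (convex_Ici Z) h.continuousOn (fun z hz => ?_) fun z hz => ?_
  · rw [interior_Ici] at hz
    exact (h.differentiableAt z hz.le).differentiableWithinAt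
  · rw [interior_Ici] at hz
    exact (h.deriv_pos z hz.le).le

/-- Since `(log ψ)' ≥ 1 / (2 z)`, the exponent `ψ` grows at least like `√z`. -/
lemma exists_log_le (h : ExponentBounds ψ Z) :
    ∃ A, ∀ z, Z ≤ z → Real.log z ≤ A + 2 * Real.log (ψ z) := by
  have hd : ∀ z, Z ≤ z →
      HasDerivAt (fun z => 2 * Real.log (ψ z) - Real.log z) (2 * (deriv ψ z / ψ z) - z⁻¹) z := by
    intro z hz
    have hz1 := h.one_le
    have hψ := h.one_le_apply z hz
    exact (((h.differentiableAt z hz).hasDerivAt.log (by linarith)).const_mul 2).sub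
      (Real.hasDerivAt_log (by linarith))
  have hm : MonotoneOn (fun z => 2 * Real.log (ψ z) - Real.log z) (Ici Z) := by
    refine monotoneOn_of_deriv_nonneg (convex_Ici Z)
      (fun z hz => (hd z hz).continuousAt.continuousWithinAt) (fun z hz => ?_) fun z hz => ?_
    · rw [interior_Ici] at hz
      exact (hd z hz.le).differentiableAt.differentiableWithinAt
    · rw [interior_Ici] at hz
      have hz' : Z ≤ z := hz.le
      rw [(hd z hz').deriv]
      have hz0 : 0 < z := by linarith [h.one_le]
      have hψ : 0 < ψ z := by linarith [h.one_le_apply z hz']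
      have h1 : (2 * z)⁻¹ ≤ deriv ψ z / ψ z := by
        rw [le_div_iff₀ hψ, inv_mul_eq_div]
        exact h.le_deriv z hz'
      rw [mul_inv] at h1
      linarith
  refine ⟨Real.log Z - 2 * Real.log (ψ Z), fun z hz => ?_⟩
  have := hm self_mem_Ici hz hz
  simp only at this
  linarith

/-- The slope of `ψ` at scale `R` is comparable to its slope at `R`. -/
lemma deriv_le_of_mem_Icc (h : ExponentBounds ψ Z) {R z : ℝ} (hR : 4 * Z ≤ R)
    (hz : z ∈ Icc (R / 4) (4 * R)) : deriv ψ z ≤ 100 * deriv ψ R := by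
  have hZ := h.one_le
  have hz0 : 0 < z := by linarith [hz.1]
  have hR0 : 0 < R := by linarith
  have hZz : Z ≤ z := by linarith [hz.1]
  have hψR := h.one_le_apply R (by linarith)
  have h1 : ψ z ≤ ψ (4 * R) := h.monotoneOn hZz (by simp only [mem_Ici]; linarith) hz.2
  have h2 := h.double_le R (by linarith)
  have h3 := h.double_le (2 * R) (by linarith)
  rw [show 2 * (2 * R) = 4 * R by ring] at h3
  have h4 := h.le_deriv R (by linarith)
  have h5 : ψ R ≤ deriv ψ R * (2 * R) := (div_le_iff₀ (by linarith)).1 h4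
  have h6 : deriv ψ z * z ≤ 2 * ψ z := (le_div_iff₀ hz0).1 (h.deriv_le z hZz)
  have h7 : 0 < deriv ψ z := h.deriv_pos z hZz
  have h8 : deriv ψ z * (R / 4) ≤ 25 * deriv ψ R * R := by nlinarith [hz.1]
  nlinarith

end ExponentBounds

lemma IsAsymptoticInverse.tendsto_atTop {ψ φ : ℝ → ℝ} {Z : ℝ} (h : IsAsymptoticInverse ψ φ)
    (hψ : ContinuousOn ψ (Ici Z)) (hlim : Tendsto ψ atTop atTop) : Tendsto φ atTop atTop := by
  obtain ⟨z₀, hz₀⟩ := eventually_atTop.1 h.1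
  refine Filter.tendsto_atTop.2 fun b => ?_
  set Y := max b (max Z z₀)
  filter_upwards [eventually_ge_atTop (ψ Y)] with s hs
  obtain ⟨b', hb', hbs⟩ := ((eventually_ge_atTop Y).and (hlim.eventually_ge_atTop s)).exists
  have hYZ : Z ≤ Y := (le_max_left _ _).trans (le_max_right _ _)
  obtain ⟨z, hz, rfl⟩ := intermediate_value_Icc hb'
    (hψ.mono fun t ht => hYZ.trans ht.1) ⟨hs, hbs⟩
  rw [hz₀ z (((le_max_right _ _).trans (le_max_right _ _)).trans hz.1)]
  exact (le_max_left _ _).trans hz.1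

/-! ### The critical radius -/

/-- A discrete intermediate value theorem for functions that oscillate by at most `κ` on
scale `r`. -/
lemma exists_mem_Icc_of_oscillation_le {G : ℝ → ℝ} {a b r κ : ℝ} (hab : a ≤ b) (hr : 0 < r)
    (ha : 0 ≤ G a) (hb : G b < 0)
    (hosc : ∀ x ∈ Icc a b, ∀ y ∈ Icc a b, |x - y| ≤ r → G x ≤ G y + κ) :
    ∃ ρ ∈ Icc a b, 0 ≤ G ρ ∧ G ρ ≤ κ := by
  set S := {x ∈ Icc a b | 0 ≤ G x}
  have haS : a ∈ S := ⟨left_mem_Icc.2 hab, ha⟩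
  have hbdd : BddAbove S := ⟨b, fun x hx => hx.1.2⟩
  obtain ⟨ρ, hρ, hlt⟩ := exists_lt_of_lt_csSup ⟨a, haS⟩ (sub_lt_self (sSup S) hr)
  refine ⟨ρ, hρ.1, hρ.2, ?_⟩
  by_cases hρb : ρ + r ≤ b
  · have hmem : ρ + r ∈ Icc a b := ⟨by linarith [hρ.1.1], hρb⟩
    have hneg : G (ρ + r) < 0 := by
      by_contra! hcon
      linarith [le_csSup hbdd (show ρ + r ∈ S from ⟨hmem, hcon⟩)]
    have := hosc ρ hρ.1 (ρ + r) hmem (by simp [abs_of_pos hr])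
    linarith
  · have := hosc ρ hρ.1 b (right_mem_Icc.2 hab)
      (by rw [abs_sub_comm, abs_of_nonneg (by linarith [hρ.1.2])]; linarith)
    linarith

lemma eventually_add_mul_log_le (a b : ℝ) : ∀ᶠ s in atTop, a + b * Real.log s ≤ s / 4 := by
  have h1 : (fun s : ℝ => a + b * Real.log s) =o[atTop] fun s : ℝ => s :=
    (Asymptotics.isLittleO_const_id_atTop a).add (Real.isLittleO_log_id_atTop.const_mul_left b)
  filter_upwards [h1.bound (show (0 : ℝ) < 1 / 4 by norm_num), eventually_ge_atTop 0] with s hs h0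
  rw [Real.norm_eq_abs, Real.norm_eq_abs, abs_of_nonneg h0] at hs
  linarith [le_abs_self (a + b * Real.log s)]

/-- With `r = min 1 (C / ψ' R)`, there is a radius `ρ` between `R / 2` and `2 R` at which
`exp (ψ R) * q * r ^ d` is bounded above and below, where `q = L * exp (-ψ)`, while `q` has bounded
oscillation on scale `r` around `ρ`. Everything is stated for logarithms. -/
lemma exists_critical_radius {ψ L : ℝ → ℝ} {Z α : ℝ} (hψ : ExponentBounds ψ Z)
    (hlim : Tendsto ψ atTop atTop) (hL : IsRegularlyVarying L α)
    (hm : Measurable fun x => Real.log (L (Real.exp x))) (d : ℕ) {C : ℝ} (hC : 0 < C) :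
    ∃ κ, ∀ᶠ R in atTop, ∃ ρ, R / 2 ≤ ρ ∧
      0 ≤ ψ R + (Real.log (L ρ) - ψ ρ) + d * Real.log (min 1 (C / deriv ψ R)) ∧
      ψ R + (Real.log (L ρ) - ψ ρ) + d * Real.log (min 1 (C / deriv ψ R)) ≤ κ ∧
      0 < L ρ ∧ ∀ y, |y - ρ| ≤ 3 * min 1 (C / deriv ψ R) →
        0 < L y ∧ |(Real.log (L y) - ψ y) - (Real.log (L ρ) - ψ ρ)| ≤ κ := by
  obtain ⟨M, hM⟩ := hL.exists_abs_log_sub_le hm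
  obtain ⟨K, hK0, hK⟩ := hL.exists_abs_log_le hm
  obtain ⟨A, hA⟩ := hψ.exists_log_le
  have hZ := hψ.one_le
  obtain ⟨Y, hY⟩ := eventually_atTop.1 (hM.and (hK.and hL.1))
  set c := min 1 (C / 2) with hc
  have hc0 : 0 < c := lt_min one_pos (by linarith)
  have hc1 : c ≤ 1 := min_le_left _ _
  refine ⟨M + 300 * C, ?_⟩
  filter_upwards [eventually_ge_atTop (4 * Z), eventually_ge_atTop (4 * Y), eventually_ge_atTop 12,
    hlim.eventually (eventually_add_mul_log_le (K * (2 + A) - d * Real.log c) (2 * K + d))]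
    with R hRZ hRY hR12 hRlog
  set r := min 1 (C / deriv ψ R) with hr
  have hψ'R : 0 < deriv ψ R := hψ.deriv_pos R (by linarith)
  have hψR : 1 ≤ ψ R := hψ.one_le_apply R (by linarith)
  have hr0 : 0 < r := lt_min one_pos (div_pos hC hψ'R)
  have hr1 : r ≤ 1 := min_le_left _ _
  have hrC : r * deriv ψ R ≤ C := (le_div_iff₀ hψ'R).1 (min_le_right _ _)
  have hrc : c / ψ R ≤ r := by
    refine le_min ((div_le_one (by linarith)).2 (hc1.trans hψR)) ?_
    rw [div_le_div_iff₀ (by linarith) hψ'R]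
    have h1 : deriv ψ R * R ≤ 2 * ψ R :=
      (le_div_iff₀ (by linarith)).1 (hψ.deriv_le R (by linarith))
    have h2 : c ≤ C / 2 := min_le_right _ _
    have h3 : deriv ψ R ≤ 2 * ψ R := by nlinarith
    nlinarith
  have hlogr : Real.log c - Real.log (ψ R) ≤ Real.log r := by
    rw [← Real.log_div hc0.ne' (by linarith)]
    exact Real.log_le_log (by positivity) hrc
  have hlogr0 : Real.log r ≤ 0 := Real.log_nonpos hr0.le hr1
  -- oscillation on scale `3 r`, first for ordered pairs of radii
  have hosc' : ∀ x ∈ Icc (R / 4) (4 * R), ∀ y ∈ Icc (R / 4) (4 * R), x ≤ y → y - x ≤ 3 * r →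
      |(Real.log (L y) - ψ y) - (Real.log (L x) - ψ x)| ≤ M + 300 * C := by
    intro x hx y hy hxy hyx
    have h1 := (hY x (by linarith [hx.1])).1 y ⟨hxy, by linarith [hx.1]⟩
    have h2 : ψ x ≤ ψ y := hψ.monotoneOn (by simp only [mem_Ici]; linarith [hx.1])
      (by simp only [mem_Ici]; linarith [hy.1]) hxy
    have h3 : ψ y - ψ x ≤ 100 * deriv ψ R * (y - x) := by
      refine (convex_Icc (R / 4) (4 * R)).image_sub_le_mul_sub_of_deriv_le
        (hψ.continuousOn.mono fun z hz => ?_) (fun z hz => ?_) (fun z hz => ?_) x hx y hy hxy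
      · simp only [mem_Ici]; linarith [hz.1]
      · rw [interior_Icc] at hz
        exact (hψ.differentiableAt z (by linarith [hz.1])).differentiableWithinAt
      · rw [interior_Icc] at hz
        exact hψ.deriv_le_of_mem_Icc hRZ ⟨hz.1.le, hz.2.le⟩
    have h4 : 100 * deriv ψ R * (y - x) ≤ 300 * C := by nlinarith
    rw [show (Real.log (L y) - ψ y) - (Real.log (L x) - ψ x) =
      (Real.log (L y) - Real.log (L x)) - (ψ y - ψ x) by ring]
    refine (abs_sub _ _).trans (add_le_add h1 ?_)
    rw [abs_of_nonneg (by linarith)]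
    linarith
  have hosc : ∀ x ∈ Icc (R / 4) (4 * R), ∀ y ∈ Icc (R / 4) (4 * R), |y - x| ≤ 3 * r →
      |(Real.log (L y) - ψ y) - (Real.log (L x) - ψ x)| ≤ M + 300 * C := by
    intro x hx y hy hxy
    rcases le_total x y with h | h
    · exact hosc' x hx y hy h ((le_abs_self _).trans hxy)
    · rw [abs_sub_comm] at hxy ⊢
      exact hosc' y hy x hx h ((le_abs_self _).trans hxy)
  have hlogR := hA R (by linarith)
  -- at `R / 2` the expected number of points is still large
  have hleft : 0 ≤ ψ R + (Real.log (L (R / 2)) - ψ (R / 2)) + d * Real.log r := by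
    have h1 := hψ.le_double (R / 2) (by linarith)
    rw [mul_div_cancel₀ R two_ne_zero] at h1
    have h2 := (hY (R / 2) (by linarith)).2.1
    have h3 : Real.log (R / 2) ≤ Real.log R := Real.log_le_log (by linarith) (by linarith)
    have h4 : K * (1 + Real.log (R / 2)) ≤ K * (2 + A + 2 * Real.log (ψ R)) := by
      exact mul_le_mul_of_nonneg_left (by linarith) hK0
    have h5 : (d : ℝ) * (Real.log c - Real.log (ψ R)) ≤ d * Real.log r := by gcongr
    linarith [neg_abs_le (Real.log (L (R / 2)))]
  -- at `2 R` it is already small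
  have hright : ψ R + (Real.log (L (2 * R)) - ψ (2 * R)) + d * Real.log r < 0 := by
    have h1 := hψ.le_double R (by linarith)
    have h2 := (hY (2 * R) (by linarith)).2.1
    have h3 : Real.log (2 * R) ≤ 1 + Real.log R := by
      rw [Real.log_mul two_ne_zero (by linarith)]
      linarith [Real.log_two_lt_d9]
    have h4 : K * (1 + Real.log (2 * R)) ≤ K * (2 + A + 2 * Real.log (ψ R)) := by
      exact mul_le_mul_of_nonneg_left (by linarith) hK0
    have h5 : (d : ℝ) * Real.log r ≤ 0 := mul_nonpos_of_nonneg_of_nonpos d.cast_nonneg hlogr0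
    have h6 : (d : ℝ) * Real.log c ≤ 0 :=
      mul_nonpos_of_nonneg_of_nonpos d.cast_nonneg (Real.log_nonpos hc0.le hc1)
    have h7 : 0 ≤ (d : ℝ) * Real.log (ψ R) := mul_nonneg d.cast_nonneg (Real.log_nonneg hψR)
    linarith [le_abs_self (Real.log (L (2 * R)))]
  obtain ⟨ρ, hρ, hρ0, hρκ⟩ := exists_mem_Icc_of_oscillation_le
    (G := fun ρ => ψ R + (Real.log (L ρ) - ψ ρ) + d * Real.log r) (κ := M + 300 * C)
    (by linarith) hr0 hleft hright fun x hx y hy hxy => by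
      have := hosc y ⟨by linarith [hy.1], by linarith [hy.2]⟩ x
        ⟨by linarith [hx.1], by linarith [hx.2]⟩ (by linarith)
      have := le_abs_self ((Real.log (L x) - ψ x) - (Real.log (L y) - ψ y))
      linarith
  refine ⟨ρ, hρ.1, hρ0, hρκ, (hY ρ (by linarith [hρ.1])).2.2, fun y hy => ?_⟩
  have hy' := abs_le.1 hy
  have hyI : y ∈ Icc (R / 4) (4 * R) :=
    ⟨by linarith [hρ.1, hy'.1], by linarith [hρ.2, hy'.2]⟩
  exact ⟨(hY y (by linarith [hyI.1])).2.2,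
    hosc ρ ⟨by linarith [hρ.1], by linarith [hρ.2]⟩ y hyI hy⟩

/-! ### Balls centred on a large sphere -/

/-- A large sphere in dimension at least two carries many points at mutual distance at least `4`. -/
lemma exists_separated_of_norm_eq {d : ℕ} (hd : 2 ≤ d) (m : ℕ) {ρ : ℝ} (hρ : 4 * m ≤ ρ) :
    ∃ x : Fin m → EuclideanSpace ℝ (Fin d), (∀ k, ‖x k‖ = ρ) ∧
      ∀ k l, k ≠ l → 4 ≤ dist (x k) (x l) := by
  have h01 : (⟨0, by omega⟩ : Fin d) ≠ ⟨1, by omega⟩ := by simp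
  set i₀ : Fin d := ⟨0, by omega⟩
  set i₁ : Fin d := ⟨1, by omega⟩
  refine ⟨fun k => EuclideanSpace.single i₀ √(ρ ^ 2 - (4 * k) ^ 2) +
    EuclideanSpace.single i₁ (4 * (k : ℝ)), fun k => ?_, fun k l hkl => ?_⟩
  · have hk : (k : ℝ) ≤ m := by exact_mod_cast k.2.le
    have hk0 : (0 : ℝ) ≤ k := Nat.cast_nonneg _
    rw [← sq_eq_sq₀ (norm_nonneg _) (by linarith), @norm_add_sq_real]
    simp only [PiLp.norm_single, Real.norm_eq_abs, sq_abs]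
    rw [Real.sq_sqrt (by nlinarith)]
    simp [EuclideanSpace.inner_single_left, h01]
  · rw [dist_eq_norm]
    refine le_trans ?_ (PiLp.norm_apply_le _ i₁)
    have h1 : (1 : ℝ) ≤ |(k : ℝ) - l| := by
      have : ((k : ℕ) : ℤ) - (l : ℕ) ≠ 0 := fun h => hkl (Fin.ext (by omega))
      exact_mod_cast Int.one_le_abs this
    simp only [PiLp.sub_apply, PiLp.add_apply, PiLp.single_apply, Real.norm_eq_abs]
    simp only [h01.symm, if_false, if_true, zero_add]
    rw [← mul_sub, abs_mul, abs_of_pos (four_pos : (0 : ℝ) < 4)]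
    linarith

section Density

variable {d : ℕ} {q : EuclideanSpace ℝ (Fin d) → ℝ}

lemma IsRadialDensity.isProbabilityMeasure (hq : IsRadialDensity q) :
    IsProbabilityMeasure (densityMeasure q) :=
  ⟨by rw [densityMeasure, withDensity_apply _ MeasurableSet.univ, setLIntegral_univ,
    hq.lintegral_eq_one]⟩

lemma volume_real_ball (x : EuclideanSpace ℝ (Fin d)) {s : ℝ} (hs : 0 < s) :
    volume.real (Metric.ball x s) =
      s ^ d * volume.real (Metric.ball (0 : EuclideanSpace ℝ (Fin d)) 1) := by
  rw [measureReal_def, Measure.addHaar_ball_of_pos volume x hs, ENNReal.toReal_mul,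
    ENNReal.toReal_ofReal (by positivity), finrank_euclideanSpace_fin, measureReal_def]

lemma IsRadialDensity.le_densityMeasure_real_ball (hq : IsRadialDensity q)
    {x : EuclideanSpace ℝ (Fin d)} {s u : ℝ} (hs : 0 < s) (hu : 0 ≤ u)
    (h : ∀ y ∈ Metric.ball x s, u ≤ q y) :
    u * (s ^ d * volume.real (Metric.ball (0 : EuclideanSpace ℝ (Fin d)) 1)) ≤
      (densityMeasure q).real (Metric.ball x s) := by
  have := hq.isProbabilityMeasure
  rw [← volume_real_ball x hs, measureReal_def, measureReal_def, ← ENNReal.toReal_ofReal hu,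
    ← ENNReal.toReal_mul]
  refine ENNReal.toReal_mono (measure_ne_top _ _) ?_
  rw [densityMeasure, withDensity_apply _ measurableSet_ball, ← setLIntegral_const]
  exact setLIntegral_mono' measurableSet_ball fun y hy => ENNReal.ofReal_le_ofReal (h y hy)

lemma densityMeasure_real_ball_le {x : EuclideanSpace ℝ (Fin d)} {s u : ℝ} (hs : 0 < s)
    (hu : 0 ≤ u) (h : ∀ y ∈ Metric.ball x s, q y ≤ u) :
    (densityMeasure q).real (Metric.ball x s) ≤
      u * (s ^ d * volume.real (Metric.ball (0 : EuclideanSpace ℝ (Fin d)) 1)) := by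
  rw [← volume_real_ball x hs, measureReal_def, measureReal_def, ← ENNReal.toReal_ofReal hu,
    ← ENNReal.toReal_mul]
  refine ENNReal.toReal_mono
    (ENNReal.mul_ne_top ENNReal.ofReal_ne_top measure_ball_lt_top.ne) ?_
  rw [densityMeasure, withDensity_apply _ measurableSet_ball, ← setLIntegral_const]
  exact setLIntegral_mono' measurableSet_ball fun y hy => ENNReal.ofReal_le_ofReal (h y hy)

/-- The regularly varying factor of a light-tailed density is measurable on the positive half-line,
since it can be read off from `q` along a ray. -/
lemma IsLightTail.measurable_log_exp {ψ L : ℝ → ℝ} (hd : 2 ≤ d) (hq : IsLightTail q ψ L) :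
    Measurable fun x => Real.log (L (Real.exp x)) := by
  have hψ : Measurable fun x => ψ (Real.exp x) :=
    (hq.vonMises.contDiffOn.continuousOn.comp_continuous Real.continuous_exp
      fun x => (Real.exp_pos x).le).measurable
  have h1 : ∀ x, L (Real.exp x) =
      q (Real.exp x • EuclideanSpace.single (⟨0, by omega⟩ : Fin d) (1 : ℝ)) *
        Real.exp (ψ (Real.exp x)) := fun x => by
    rw [hq.eq, norm_smul, PiLp.norm_single, norm_one, mul_one, Real.norm_eq_abs,
      Real.abs_exp, mul_assoc, ← Real.exp_add, neg_add_cancel, Real.exp_zero, mul_one]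
  simp_rw [h1]
  have h2 : Measurable fun x : ℝ =>
      q (Real.exp x • EuclideanSpace.single (⟨0, by omega⟩ : Fin d) (1 : ℝ)) :=
    hq.density.measurable.comp (Real.measurable_exp.smul_const _)
  exact (h2.mul hψ.exp).log

end Density

/-! ### Disconnectedness -/

/-- For every `m` and all large `n`, there are `m` disjoint balls in which the expected numbers of
sample points, and those of the concentric balls of half the radius, are bounded above and below by
constants that do not depend on `m`; so the graph is disconnected with the probability that the
second moment method gives for `m` events. -/
lemma exists_forall_eventually_le_measureReal_isDisconnected {d : ℕ} (hd : 2 ≤ d)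
    (q : EuclideanSpace ℝ (Fin d) → ℝ) (ψ L ψinv : ℝ → ℝ)
    (hq : HasExponentialDecay q ψ L) (hψinv : IsAsymptoticInverse ψ ψinv)
    (r : ℕ → ℝ) (hr_le : ∀ n, r n ≤ 1)
    (hr : (fun n : ℕ => r n * deriv ψ (ψinv (Real.log n))) =O[atTop] fun _ => (1 : ℝ))
    {Ω : ℕ → Type*} [∀ n, MeasurableSpace (Ω n)]
    (P : ∀ n, Measure (Ω n)) [∀ n, IsProbabilityMeasure (P n)]
    (N : ∀ n, Ω n → ℕ) (X : ∀ n, ℕ → Ω n → EuclideanSpace ℝ (Fin d))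
    (hX : ∀ n : ℕ, IsPoissonSample (P n) (n : ℝ≥0) (densityMeasure q) (N n) (X n)) :
    ∃ p : ℝ, 0 < p ∧ ∀ m : ℕ, 1 < m * p → ∀ᶠ n in atTop, 1 - m / (m * p - 1) ^ 2 ≤
      (P n).real {ω | IsDisconnected (geometricGraph (pointCloud (N n) (X n) ω) (r n))} := by
  have hdens := hq.lightTail.density
  have := hdens.isProbabilityMeasure
  have hψlim := hq.lightTail.vonMises.tendsto_atTop
  obtain ⟨Z, hZ⟩ := exists_exponentBounds hq.lightTail.vonMises hq.lightTail.deriv_monotone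
    hq.regularlyVarying_one
  obtain ⟨α, hL⟩ := hq.lightTail.regularlyVarying
  obtain ⟨C, hC, hrC⟩ := hr.exists_pos
  obtain ⟨κ, hκ⟩ := exists_critical_radius hZ hψlim hL
    (hq.lightTail.measurable_log_exp hd) d hC
  set v := volume.real (Metric.ball (0 : EuclideanSpace ℝ (Fin d)) 1) with hv
  have hv0 : 0 < v :=
    ENNReal.toReal_pos (Metric.measure_ball_pos _ _ one_pos).ne' measure_ball_lt_top.ne
  set a := Real.exp (-κ) * v with ha
  set b := Real.exp κ * Real.exp κ * 2 ^ d * v with hb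
  have ha0 : 0 < a := mul_pos (Real.exp_pos _) hv0
  refine ⟨Real.exp (-b) * (1 - Real.exp (-a)), mul_pos (Real.exp_pos _)
    (sub_pos.2 (Real.exp_lt_one_iff.2 (by linarith))), fun m hm => ?_⟩
  have hlogn : Tendsto (fun n : ℕ => Real.log n) atTop atTop :=
    Real.tendsto_log_atTop.comp tendsto_natCast_atTop_atTop
  have hRlim : Tendsto (fun n : ℕ => ψinv (Real.log n)) atTop atTop :=
    (hψinv.tendsto_atTop hZ.continuousOn hψlim).comp hlogn
  filter_upwards [hRlim.eventually hκ, hRlim.eventually_ge_atTop Z,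
    hRlim.eventually_ge_atTop (8 * m), hlogn.eventually hψinv.2, hrC.bound,
    eventually_gt_atTop 0] with n hn hnZ hnm hnψ hnC hn0
  set R := ψinv (Real.log n)
  set s := min 1 (C / deriv ψ R) with hs
  have hψ' : 0 < deriv ψ R := hZ.deriv_pos R hnZ
  have hs0 : 0 < s := lt_min one_pos (div_pos hC hψ')
  have hs1 : s ≤ 1 := min_le_left _ _
  have hrs : r n ≤ s := by
    refine le_min (hr_le n) ((le_div_iff₀ hψ').2 ?_)
    rw [norm_one, mul_one, Real.norm_eq_abs] at hnC
    exact (le_abs_self _).trans hnC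
  obtain ⟨ρ, hρR, hρ0, hρκ, hLρ, hosc⟩ := hn
  set Q := Real.exp (Real.log (L ρ) - ψ ρ) with hQ
  -- the normalisation of the radius: `n Q s ^ d` is bounded above and below
  have hnQ : (n : ℝ) * Q * s ^ d =
      Real.exp (ψ R + (Real.log (L ρ) - ψ ρ) + d * Real.log s) := by
    rw [Real.exp_add, Real.exp_add, hnψ, Real.exp_log (by exact_mod_cast hn0), mul_comm (d : ℝ),
      Real.exp_mul, Real.exp_log hs0, Real.rpow_natCast]
  have hnQ1 : 1 ≤ (n : ℝ) * Q * s ^ d := hnQ ▸ Real.one_le_exp hρ0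
  have hnQκ : (n : ℝ) * Q * s ^ d ≤ Real.exp κ := hnQ ▸ Real.exp_le_exp.2 hρκ
  obtain ⟨x, hxρ, hxd⟩ := exists_separated_of_norm_eq hd m (show 4 * m ≤ ρ by linarith)
  have hqy : ∀ k, ∀ y ∈ Metric.ball (x k) (2 * s),
      Real.exp (-κ) * Q ≤ q y ∧ q y ≤ Real.exp κ * Q := by
    intro k y hy
    have h1 : |‖y‖ - ρ| ≤ 3 * s := by
      rw [← hxρ k]
      refine (abs_norm_sub_norm_le _ _).trans ?_
      rw [← dist_eq_norm]
      linarith [Metric.mem_ball.1 hy]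
    obtain ⟨hLy, hy2⟩ := hosc _ h1
    have hy3 := abs_le.1 hy2
    have hqe : q y = Real.exp (Real.log (L ‖y‖) - ψ ‖y‖) := by
      rw [hq.lightTail.eq, sub_eq_add_neg, Real.exp_add, Real.exp_log hLy]
    rw [hqe, hQ, ← Real.exp_add, ← Real.exp_add]
    exact ⟨Real.exp_le_exp.2 (by linarith [hy3.1]), Real.exp_le_exp.2 (by linarith [hy3.2])⟩
  refine (hX n).le_measureReal_isDisconnected (fun k => Metric.ball (x k) s)
    (fun k => Metric.ball (x k) (2 * s)) (fun _ => measurableSet_ball)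
    (fun _ => measurableSet_ball) (fun k => Metric.ball_subset_ball (by linarith))
    (fun k u hu w huw => ?_) (fun k l hkl => ?_) ha0.le (fun k => ?_) (fun k => ?_) hm
  · rw [Metric.mem_ball] at hu ⊢
    linarith [dist_triangle w u (x k), dist_comm u w]
  · exact Metric.ball_disjoint_ball (by linarith [hxd k l hkl])
  · have h1 := hdens.le_densityMeasure_real_ball hs0
      (u := Real.exp (-κ) * Q) (by positivity) fun y hy =>
        (hqy k y (Metric.ball_subset_ball (by linarith) hy)).1
    rw [← hv] at h1
    calc a ≤ a * (n * Q * s ^ d) := le_mul_of_one_le_right ha0.le hnQ1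
      _ = n * (Real.exp (-κ) * Q * (s ^ d * v)) := by rw [ha]; ring
      _ ≤ _ := by
        rw [NNReal.coe_natCast]
        exact mul_le_mul_of_nonneg_left h1 n.cast_nonneg
  · have h1 := densityMeasure_real_ball_le (q := q) (x := x k) (s := 2 * s) (by linarith)
      (u := Real.exp κ * Q) (by positivity) fun y hy => (hqy k y hy).2
    rw [← hv] at h1
    calc ((n : ℝ≥0) : ℝ) * (densityMeasure q).real (Metric.ball (x k) (2 * s))
        ≤ n * (Real.exp κ * Q * ((2 * s) ^ d * v)) := by
          rw [NNReal.coe_natCast]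
          exact mul_le_mul_of_nonneg_left h1 n.cast_nonneg
      _ = Real.exp κ * 2 ^ d * v * (n * Q * s ^ d) := by rw [mul_pow]; ring
      _ ≤ Real.exp κ * 2 ^ d * v * Real.exp κ :=
          mul_le_mul_of_nonneg_left hnQκ (by positivity)
      _ = b := by rw [hb]; ring

theorem mainTheorem3 {d : ℕ} (hd : 2 ≤ d)
    (q : EuclideanSpace ℝ (Fin d) → ℝ) (ψ L ψinv : ℝ → ℝ)
    (hq : HasExponentialDecay q ψ L) (hψinv : IsAsymptoticInverse ψ ψinv)
    (r : ℕ → ℝ) (hr_pos : ∀ n, 0 < r n) (hr_le : ∀ n, r n ≤ 1) (hr_anti : Antitone r)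
    (hr : (fun n : ℕ => r n * deriv ψ (ψinv (Real.log n))) =O[atTop] fun _ => (1 : ℝ))
    {Ω : ℕ → Type*} [∀ n, MeasurableSpace (Ω n)]
    (P : ∀ n, Measure (Ω n)) [∀ n, IsProbabilityMeasure (P n)]
    (N : ∀ n, Ω n → ℕ) (X : ∀ n, ℕ → Ω n → EuclideanSpace ℝ (Fin d))
    (hX : ∀ n : ℕ, IsPoissonSample (P n) (n : ℝ≥0) (densityMeasure q) (N n) (X n)) :
    Tendsto
      (fun n => P n {ω | IsDisconnected (geometricGraph (pointCloud (N n) (X n) ω) (r n))})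
      atTop (𝓝 1) := by
  obtain ⟨p, hp, h⟩ := exists_forall_eventually_le_measureReal_isDisconnected hd q ψ L ψinv hq
    hψinv r hr_le hr P N X hX
  rw [← ENNReal.tendsto_toReal_iff (fun n => measure_ne_top _ _) ENNReal.one_ne_top,
    ENNReal.toReal_one]
  refine tendsto_order.2 ⟨fun t ht => ?_, fun t ht => ?_⟩
  · obtain ⟨m, hm⟩ := exists_nat_gt (max (2 / p) (4 / (p ^ 2 * (1 - t))))
    have h1 : 2 < m * p := (div_lt_iff₀ hp).1 ((le_max_left _ _).trans_lt hm)
    have h2 : 4 < m * (p ^ 2 * (1 - t)) :=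
      (div_lt_iff₀ (mul_pos (by positivity) (by linarith))).1 ((le_max_right _ _).trans_lt hm)
    have hm0 : (0 : ℝ) < m := pos_of_mul_pos_left (by linarith) hp.le
    -- `m p - 1 ≥ m p / 2`, so that the error term is at most `4 / (m p ^ 2)`
    have h3 : m / (m * p - 1) ^ 2 < 1 - t := by
      have h4 : (m * p / 2) ^ 2 ≤ (m * p - 1) ^ 2 :=
        pow_le_pow_left₀ (by positivity) (by linarith) 2
      rw [div_lt_iff₀ (pow_pos (by linarith) 2)]
      nlinarith
    filter_upwards [h m (by linarith)] with n hn
    rw [measureReal_def] at hn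
    linarith
  · refine Eventually.of_forall fun n => ?_
    rw [← measureReal_def]
    exact measureReal_le_one.trans_lt ht
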